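/- Graphs are finite and loopless, with multiple edges allowed; let $k$ be a positive integer. For a graph $G$, let $\kappa'(G)$ be its edge-connectivity, $\tau(G)$ the maximum number of pairwise edge-disjoint spanning trees of $G$, and $\omega(G)$ the number of components of $G$. Let $\mathcal F_{k,n}$ be the set of graphs $G$ with $|V(G)|=n$ and $\kappa'(G)=\tau(G)=k$ for which $|E(G)|$ is minimum among all graphs with these properties, and let $\mathcal F_k=\bigcup_{n>1}\mathcal F_{k,n}$. The density of a graph $G$ with at least one edge is $d(G)=\frac{|E(G)|}{|V(G)|-\omega(G)}$, and $G$ is called uniformly dense if $d(G)=\gamma(G)$, where $\gamma(G)=\max d(H)$ over all subgraphs $H$ of $G$ with $|V(H)|\neq\omega(H)$. If $G_1$ and $G_2$ are connected graphs with $V(G_1)\cap V(G_2)=\emptyset$ and $K$ is a set of $k$ edges (parallel edges allowed), each with one end in $V(G_1)$ and the other in $V(G_2)$, then the graph with vertex set $V(G_1)\cup V(G_2)$ and edge set $E(G_1)\cup E(G_2)\cup K$ is called a $k$-edge-join of $G_1$ and $G_2$, written $G_1*_kG_2$. **Theorem.** Let $k$ be a positive integer. A graph $G$ belongs to $\mathcal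 F_k$ if and only if there are connected, vertex-disjoint graphs $G_1$ and $G_2$ such that $G=G_1*_kG_2$ and, for each $i\in\{1,2\}$, either $G_i=K_1$ or $G_i$ is uniformly dense with density $d(G_i)=k$. -/

import Mathlib

namespace EdgeJoin

universe u v

/-- The graphs considered: finite graphs, with possible multiple edges but without loops,
as Mathlib's multigraphs `Graph α β` (vertices in `α`, edges in `β`). -/
structure IsMultigraph {α : Type u} {β : Type v} (G : Graph α β) : Prop where
  finite_vertexSet : G.vertexSet.Finite
  finite_edgeSet : G.edgeSet.Finite
  loopless : G.Loopless

/-- For a vertex `x` of `G`: `y` is joined to `x` by a walk in `G`. -/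
def Reachable {α : Type u} {β : Type v} (G : Graph α β) (x y : α) : Prop :=
  Relation.ReflTransGen G.Adj x y

/-- `G` has a vertex, and any two of its vertices are joined by a walk. -/
def Connected {α : Type u} {β : Type v} (G : Graph α β) : Prop :=
  G.vertexSet.Nonempty ∧ ∀ x ∈ G.vertexSet, ∀ y ∈ G.vertexSet, Reachable G x y

/-- `G` has no cycles: no edge `e` lies on a cycle of `G`, that is, the ends of `e` are not joined
by a walk (equivalently, a path) that avoids `e`. (A loop is a cycle of length one, and two
parallel edges form a cycle of length two.) -/
def Acyclic {α : Type u} {β : Type v} (G : Graph α β) : Prop :=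
  ∀ e x y, G.IsLink e x y → ¬ Reachable (G.deleteEdges {e}) x y

/-- A tree: a connected graph without cycles. -/
def IsTree {α : Type u} {β : Type v} (G : Graph α β) : Prop :=
  Connected G ∧ Acyclic G

/-- The number of components of `G`; a component is represented by its set of vertices. -/
noncomputable def numComponents {α : Type u} {β : Type v} (G : Graph α β) : ℕ :=
  ((fun x => {y | Reachable G x y}) '' G.vertexSet).ncard

/-- The set of edges of `G` with one end in `X` and the other end outside `X`. -/
def edgeBoundary {α : Type u} {β : Type v} (G : Graph α β) (X : Set α) : Set β :=
  {e | ∃ x y, G.IsLink e x y ∧ x ∈ X ∧ y ∉ X}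

/-- The edge-connectivity `κ'(G)`: the minimum number of edges between `X` and `V(G) \ X`, over
all nonempty proper subsets `X` of `V(G)` (and `∞` if there is no such `X`). -/
noncomputable def edgeConnectivity {α : Type u} {β : Type v} (G : Graph α β) : ℕ∞ :=
  ⨅ (X : Set α) (_ : X.Nonempty ∧ X ⊂ G.vertexSet), (edgeBoundary G X).encard

/-- `T 0, …, T (m - 1)` are the edge sets of `m` pairwise edge-disjoint spanning trees of `G`. -/
def IsTreePacking {α : Type u} {β : Type v} (G : Graph α β) {m : ℕ} (T : Fin m → Set β) : Prop :=
  (∀ i, T i ⊆ G.edgeSet ∧ IsTree (G.restrict (T i))) ∧ ∀ i j, i ≠ j → Disjoint (T i) (T j)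

/-- The maximum number `τ(G)` of pairwise edge-disjoint spanning trees of `G`
(`∞` for a single vertex). -/
noncomputable def treePackingNumber {α : Type u} {β : Type v} (G : Graph α β) : ℕ∞ :=
  ⨆ (m : ℕ) (_ : ∃ T : Fin m → Set β, IsTreePacking G T), (m : ℕ∞)

/-- The density `d(G) = |E(G)| / (|V(G)| - ω(G))`, meaningful when `|V(G)| ≠ ω(G)`. -/
noncomputable def density {α : Type u} {β : Type v} (G : Graph α β) : ℚ :=
  (G.edgeSet.ncard : ℚ) / ((G.vertexSet.ncard : ℚ) - (numComponents G : ℚ))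

/-- `g = γ(G)`: `g` is the maximum of the densities `d(H)`, over all subgraphs `H` of `G`
for which the denominator `|V(H)| - ω(H)` is nonzero. -/
def IsMaxDensity {α : Type u} {β : Type v} (G : Graph α β) (g : ℚ) : Prop :=
  IsGreatest {d : ℚ | ∃ H : Graph α β, H ≤ G ∧ H.vertexSet.ncard ≠ numComponents H ∧
    d = density H} g

/-- `G` has an edge and `d(G) = γ(G)`. -/
def UniformlyDense {α : Type u} {β : Type v} (G : Graph α β) : Prop :=
  G.edgeSet.Nonempty ∧ IsMaxDensity G (density G)

/-- `G` is a graph with `n` vertices and `κ'(G) = τ(G) = k`. -/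
def Feasible {α : Type u} {β : Type v} (k n : ℕ) (G : Graph α β) : Prop :=
  IsMultigraph G ∧ G.vertexSet.ncard = n ∧ edgeConnectivity G = k ∧ treePackingNumber G = k

/-- `G ∈ 𝓕_{k,n}`: `G` is a graph with `n` vertices and `κ'(G) = τ(G) = k`, and `|E(G)|` is minimum
among all such graphs `H` (on arbitrary vertex and edge types). -/
def MemFkn {α : Type u} {β : Type v} (k n : ℕ) (G : Graph α β) : Prop :=
  Feasible k n G ∧
    ∀ (α' : Type u) (β' : Type v) (H : Graph α' β'), Feasible k n H →
      G.edgeSet.ncard ≤ H.edgeSet.ncard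

/-- `G ∈ 𝓕_k`, the union of the families `𝓕_{k,n}` over `n > 1`. -/
def MemFk {α : Type u} {β : Type v} (k : ℕ) (G : Graph α β) : Prop :=
  ∃ n : ℕ, 1 < n ∧ MemFkn k n G

/-- `G` is a `K₁`: one vertex and no edges. -/
def IsK1 {α : Type u} {β : Type v} (G : Graph α β) : Prop :=
  ∃ x : α, G = Graph.noEdge {x} β

/-- `G = G₁ *_K G₂`: the graphs `G₁` and `G₂` are connected and vertex-disjoint, every edge in `K`
has one end in `V(G₁)` and the other in `V(G₂)`, and `G` is the graph with vertex set
`V(G₁) ∪ V(G₂)` and edge set `E(G₁) ∪ E(G₂) ∪ K`, with the incidences of `G₁` and `G₂`. -/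
structure IsEdgeJoin {α : Type u} {β : Type v} (G G₁ G₂ : Graph α β) (K : Set β) : Prop where
  connected_left : Connected G₁
  connected_right : Connected G₂
  disjoint : Disjoint G₁.vertexSet G₂.vertexSet
  left_le : G₁ ≤ G
  right_le : G₂ ≤ G
  link_join : ∀ e ∈ K, ∃ x ∈ G₁.vertexSet, ∃ y ∈ G₂.vertexSet, G.IsLink e x y
  vertexSet_eq : G.vertexSet = G₁.vertexSet ∪ G₂.vertexSet
  edgeSet_eq : G.edgeSet = G₁.edgeSet ∪ G₂.edgeSet ∪ K

/-- `G = G₁ *_k G₂`, a `k`-edge-join: `G = G₁ *_K G₂` for some set `K` of `k` edges. -/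
def IsKEdgeJoin {α : Type u} {β : Type v} (k : ℕ) (G G₁ G₂ : Graph α β) : Prop :=
  ∃ K : Set β, K.encard = k ∧ IsEdgeJoin G G₁ G₂ K

end EdgeJoin

/-!
Let `n = |V(G)|`. Disjoint spanning trees cross every cut, so that `τ ≤ κ'`; and `k` disjoint
spanning trees have `k (n - 1)` edges in total. A star in which each leaf is joined to the centre by
`k` parallel edges has `κ' = τ = k` and exactly `k (n - 1)` edges, so the members of `𝓕_k` are the
graphs with `n > 1` and `κ' = τ = k` whose edge set is a disjoint union of `k` spanning trees
(`memFk_iff`).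

The link with density is the arboricity theorem of Nash-Williams
(`exists_isForestPacking_iUnion_eq`): a graph all of whose edge sets `F` satisfy
`|F| ≤ k (|V| - ω(F))` is a disjoint union of `k` forests. In a connected graph with `k (n - 1)`
edges, forests that cover the edges have to be spanning trees. Hence, a connected graph is `K₁` or
uniformly dense with density `k` if and only if it decomposes into `k` spanning trees
(`isK1_or_uniformlyDense_iff`).

It remains to see that `G` belongs to `𝓕_k` if and only if it is a `k`-edge-join of two connected
graphs that decompose into `k` spanning trees. In such a join, each joining edge links a tree of one
side to a tree of the other, and the joining edges form a cut of size `k`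
(`memFk_of_isKEdgeJoin`). Conversely, let the edges of `G` decompose into `k` spanning trees and let
a cut of size `k` have the sides `G₁` and `G₂`. Each `Gᵢ` is covered by `k` forests, so it has at most
`k (|V(Gᵢ)| - ω(Gᵢ))` edges; as `G` has `k (n - 1)` edges, both bounds hold with equality and
`ω(Gᵢ) = 1`, so each `Gᵢ` decomposes into `k` spanning trees (`exists_isKEdgeJoin_of_memFk`).
-/

namespace EdgeJoin

open Set

universe u v

variable {α β ι : Type*} {G H G₁ G₂ : Graph α β} {x y u v : α} {e f : β} {A B K : Set β}
  {k m : ℕ}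

/-! ### Reachability -/

lemma Reachable.symm (h : Reachable G x y) : Reachable G y x :=
  (Relation.ReflTransGen.stdSymm (r := G.Adj)).symm _ _ h

lemma Reachable.trans (h : Reachable G x y) (h' : Reachable G y u) : Reachable G x u :=
  Relation.ReflTransGen.trans h h'

lemma Reachable.refl (G : Graph α β) (x : α) : Reachable G x x :=
  Relation.ReflTransGen.refl

lemma reachable_of_isLink (h : G.IsLink e x y) : Reachable G x y :=
  Relation.ReflTransGen.single ⟨e, h⟩

/-- If the ends of each edge of `G` are joined by a walk in `H`, then so are any two vertices that
are joined by a walk in `G`. -/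
lemma Reachable.of_forall_isLink (h : Reachable G x y)
    (hGH : ∀ e u v, G.IsLink e u v → Reachable H u v) : Reachable H x y := by
  induction h with
  | refl => exact .refl _ _
  | tail _ hbc ih =>
    obtain ⟨e, he⟩ := hbc
    exact ih.trans (hGH e _ _ he)

lemma Reachable.mono (h : Reachable H x y) (hHG : H ≤ G) : Reachable G x y :=
  h.of_forall_isLink fun _ _ _ he => reachable_of_isLink (he.mono hHG)

lemma Reachable.restrict_mono (h : Reachable (G.restrict A) x y) (hAB : A ⊆ B) :
    Reachable (G.restrict B) x y :=
  h.mono (G.restrict_mono_right hAB)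

/-- A walk that leaves `X` uses an edge of the boundary of `X`. -/
lemma Reachable.exists_mem_edgeBoundary (h : Reachable G x y) {X : Set α} (hx : x ∈ X)
    (hy : y ∉ X) : (edgeBoundary G X).Nonempty := by
  induction h with
  | refl => exact absurd hx hy
  | @tail b c _ hbc ih =>
    by_cases hb : b ∈ X
    · obtain ⟨e, he⟩ := hbc
      exact ⟨e, b, c, he, hb, hy⟩
    · exact ih hb

/-- A walk in `A + e`, where `e = xy`, can be taken to use `e` at most once. -/
lemma Reachable.of_restrict_insert (he : G.IsLink e x y)
    (h : Reachable (G.restrict (insert e A)) u v) :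
    Reachable (G.restrict A) u v ∨
      (Reachable (G.restrict A) u x ∧ Reachable (G.restrict A) y v) ∨
      (Reachable (G.restrict A) u y ∧ Reachable (G.restrict A) x v) := by
  induction h with
  | refl => exact .inl (.refl _ _)
  | @tail b c _ hbc ih =>
    obtain ⟨f, hf, hfG⟩ := hbc
    by_cases hfA : f ∈ A
    · have hbc : Reachable (G.restrict A) b c := reachable_of_isLink (e := f) ⟨hfA, hfG⟩
      rcases ih with h | ⟨h, h'⟩ | ⟨h, h'⟩
      · exact .inl (h.trans hbc)
      · exact .inr (.inl ⟨h, h'.trans hbc⟩)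
      · exact .inr (.inr ⟨h, h'.trans hbc⟩)
    · obtain rfl : f = e := hf.resolve_right hfA
      rcases hfG.eq_and_eq_or_eq_and_eq he with ⟨rfl, rfl⟩ | ⟨rfl, rfl⟩
      · rcases ih with h | ⟨h, h'⟩ | ⟨h, h'⟩
        · exact .inr (.inl ⟨h, .refl _ _⟩)
        · exact .inr (.inl ⟨h, .refl _ _⟩)
        · exact .inl h
      · rcases ih with h | ⟨h, h'⟩ | ⟨h, h'⟩
        · exact .inr (.inr ⟨h, .refl _ _⟩)
        · exact .inl h
        · exact .inr (.inr ⟨h, .refl _ _⟩)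

/-! ### Acyclic sets of edges -/

lemma Acyclic.mono (h : Acyclic G) (hHG : H ≤ G) : Acyclic H := fun e x y he hr =>
  h e x y (he.mono hHG) (hr.mono (Graph.deleteEdges_mono_left hHG _))

lemma deleteEdges_restrict_singleton :
    (G.restrict A).deleteEdges {e} = G.restrict (A \ {e}) := by
  ext
  · rfl
  · simp; tauto

lemma acyclic_restrict_iff : Acyclic (G.restrict A) ↔
    ∀ e ∈ A, ∀ x y, G.IsLink e x y → ¬ Reachable (G.restrict (A \ {e})) x y := by
  simp only [Acyclic, deleteEdges_restrict_singleton, Graph.restrict_isLink]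
  exact ⟨fun h e he x y hl => h e x y ⟨he, hl⟩, fun h e x y hl => h e hl.1 x y hl.2⟩

lemma acyclic_restrict_empty : Acyclic (G.restrict ∅) := by
  simp [acyclic_restrict_iff]

lemma Acyclic.insert (h : Acyclic (G.restrict A)) (he : G.IsLink e x y)
    (hxy : ¬ Reachable (G.restrict A) x y) : Acyclic (G.restrict (insert e A)) := by
  rw [acyclic_restrict_iff] at h ⊢
  intro f hf u v hfl hr
  by_cases hfe : f = e
  · subst hfe
    have hr' := hr.restrict_mono (B := A) (by simp)
    rcases hfl.eq_and_eq_or_eq_and_eq he with ⟨rfl, rfl⟩ | ⟨rfl, rfl⟩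
    · exact hxy hr'
    · exact hxy hr'.symm
  · have hfA : f ∈ A := hf.resolve_left hfe
    have hss : Insert.insert e A \ {f} = Insert.insert e (A \ {f}) :=
      (insert_sdiff_singleton_comm (Ne.symm hfe) A).symm
    rw [hss] at hr
    have huv : Reachable (G.restrict A) u v := reachable_of_isLink (e := f) ⟨hfA, hfl⟩
    have hsub : A \ {f} ⊆ A := sdiff_subset
    rcases hr.of_restrict_insert he with h1 | ⟨h1, h2⟩ | ⟨h1, h2⟩
    · exact h f hfA u v hfl h1
    · exact hxy (((h1.restrict_mono hsub).symm.trans huv).trans (h2.restrict_mono hsub).symm)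
    · exact hxy (((h2.restrict_mono hsub).trans huv.symm).trans (h1.restrict_mono hsub))

/-- In a forest, the edges whose removal separates `x` from `y` are those of the path from `x` to
`y`: any set `B` that contains all of them still joins `x` to `y`. -/
lemma Acyclic.reachable_restrict_inter (h : Acyclic (G.restrict A)) (hA : A.Finite)
    (hxy : Reachable (G.restrict A) x y)
    (hB : ∀ f ∈ A, ¬ Reachable (G.restrict (A \ {f})) x y → f ∈ B) :
    Reachable (G.restrict (A ∩ B)) x y := by
  -- a minimal subset `J` of `A` joining `x` to `y`
  obtain ⟨J, hJ⟩ := (hA.finite_subsets.subset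
    (t := {J | J ⊆ A ∧ Reachable (G.restrict J) x y}) (fun J hJ => hJ.1)).exists_minimal
      ⟨A, subset_rfl, hxy⟩
  refine hJ.prop.2.restrict_mono fun f hf => ⟨hJ.prop.1 hf, ?_⟩
  by_cases hfl : f ∈ G.edgeSet
  swap
  · have : J \ {f} ∈ {J | J ⊆ A ∧ Reachable (G.restrict J) x y} := by
      refine ⟨sdiff_subset.trans hJ.prop.1, hJ.prop.2.of_forall_isLink fun g u v hg => ?_⟩
      refine reachable_of_isLink (e := g) ⟨⟨hg.1, ?_⟩, hg.2⟩
      rintro rfl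
      exact hfl hg.2.edge_mem
    exact absurd (hJ.le_of_le this sdiff_subset hf).2 (by simp)
  obtain ⟨u, v, huv⟩ := G.exists_isLink_of_mem_edgeSet hfl
  refine hB f (hJ.prop.1 hf) fun hr => ?_
  have hnot : ¬ Reachable (G.restrict (J \ {f})) x y := fun hr' =>
    (hJ.le_of_le (y := J \ {f}) ⟨sdiff_subset.trans hJ.prop.1, hr'⟩ sdiff_subset hf).2 rfl
  have hJr := hJ.prop.2
  rw [← insert_sdiff_self_of_mem hf] at hJr
  have hsub : J \ {f} ⊆ A \ {f} := sdiff_subset_sdiff_left hJ.prop.1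
  have hcyc := acyclic_restrict_iff.1 h f (hJ.prop.1 hf) u v huv
  rcases hJr.of_restrict_insert huv with h1 | ⟨h1, h2⟩ | ⟨h1, h2⟩
  · exact hnot h1
  · exact hcyc (((h1.restrict_mono hsub).symm.trans hr).trans (h2.restrict_mono hsub).symm)
  · exact hcyc (((h2.restrict_mono hsub).trans hr.symm).trans (h1.restrict_mono hsub))

/-! ### Counting components -/

lemma class_eq_iff : {z | Reachable G x z} = {z | Reachable G y z} ↔ Reachable G x y := by
  refine ⟨fun h => ?_, fun h => ?_⟩
  · have : y ∈ {z | Reachable G y z} := .refl _ _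
    rwa [← h] at this
  · ext z
    exact ⟨h.symm.trans, h.trans⟩

lemma numComponents_le_card (hV : G.vertexSet.Finite) :
    numComponents G ≤ G.vertexSet.ncard :=
  ncard_image_le hV

lemma numComponents_pos (hV : G.vertexSet.Finite) (hne : G.vertexSet.Nonempty) :
    0 < numComponents G :=
  (ncard_pos (hV.image _)).2 (hne.image _)

lemma connected_iff_numComponents :
    Connected G ↔ numComponents G = 1 := by
  unfold numComponents
  rw [ncard_eq_one]
  constructor
  · rintro ⟨⟨x, hx⟩, h⟩
    refine ⟨{z | Reachable G x z}, subset_antisymm ?_ (by simpa using ⟨x, hx, rfl⟩)⟩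
    rintro _ ⟨y, hy, rfl⟩
    exact class_eq_iff.2 (h y hy x hx)
  · rintro ⟨S, hS⟩
    refine ⟨?_, fun x hx y hy => ?_⟩
    · rw [← image_nonempty, hS]
      exact singleton_nonempty _
    · have hx' := hS.subset (mem_image_of_mem _ hx)
      have hy' := hS.subset (mem_image_of_mem _ hy)
      exact class_eq_iff.1 (hx'.trans hy'.symm)

/-- The number of components does not increase when walks are added. -/
lemma numComponents_anti (hV : G.vertexSet.Finite) (hVH : H.vertexSet = G.vertexSet)
    (h : ∀ x y, Reachable H x y → Reachable G x y) : numComponents G ≤ numComponents H := by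
  have hE : (fun x => {y | Reachable G x y}) '' G.vertexSet =
      (fun S => {z | ∃ y ∈ S, Reachable G y z}) ''
        ((fun x => {y | Reachable H x y}) '' H.vertexSet) := by
    rw [image_image, hVH]
    refine image_congr fun x _ => ?_
    ext z
    exact ⟨fun hz => ⟨x, .refl _ _, hz⟩, fun ⟨y, hy, hyz⟩ => (h x y hy).trans hyz⟩
  unfold numComponents
  rw [hE]
  exact ncard_image_le ((hVH ▸ hV).image _)

lemma numComponents_restrict_insert_of_reachable (hV : G.vertexSet.Finite)
    (he : G.IsLink e x y) (hxy : Reachable (G.restrict A) x y) :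
    numComponents (G.restrict (insert e A)) = numComponents (G.restrict A) := by
  refine le_antisymm ?_ ?_
  · exact numComponents_anti (by exact hV) rfl fun u v h => h.restrict_mono (subset_insert _ _)
  · refine numComponents_anti (by exact hV) rfl fun u v h => ?_
    rcases h.of_restrict_insert he with h | ⟨h, h'⟩ | ⟨h, h'⟩
    · exact h
    · exact (h.trans hxy).trans h'
    · exact (h.trans hxy.symm).trans h'

/-- Adding an edge between two components merges them into one. -/
lemma numComponents_restrict_insert_of_not_reachable (hV : G.vertexSet.Finite)
    (he : G.IsLink e x y) (hxy : ¬ Reachable (G.restrict A) x y) :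
    numComponents (G.restrict (insert e A)) + 1 = numComponents (G.restrict A) := by
  set c := fun u => {z | Reachable (G.restrict A) u z} with hc
  set c' := fun u => {z | Reachable (G.restrict (insert e A)) u z} with hc'
  have hmono : ∀ {u v}, Reachable (G.restrict A) u v → Reachable (G.restrict (insert e A)) u v :=
    fun h => h.restrict_mono (subset_insert _ _)
  have hxy' : Reachable (G.restrict (insert e A)) x y :=
    reachable_of_isLink (e := e) ⟨mem_insert _ _, he⟩
  -- the vertices outside the old component of `y` meet every new component
  have h1 : c' '' G.vertexSet = c' '' {u ∈ G.vertexSet | ¬ Reachable (G.restrict A) u y} := by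
    refine subset_antisymm ?_ (image_mono fun u hu => hu.1)
    rintro _ ⟨u, hu, rfl⟩
    by_cases huy : Reachable (G.restrict A) u y
    · exact ⟨x, ⟨he.left_mem, hxy⟩, class_eq_iff.2 (hxy'.trans (hmono huy.symm))⟩
    · exact ⟨u, ⟨hu, huy⟩, rfl⟩
  have h2 : c '' G.vertexSet =
      insert (c y) (c '' {u ∈ G.vertexSet | ¬ Reachable (G.restrict A) u y}) := by
    refine subset_antisymm ?_ (insert_subset ⟨y, he.right_mem, rfl⟩ (image_mono fun u hu => hu.1))
    rintro _ ⟨u, hu, rfl⟩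
    by_cases huy : Reachable (G.restrict A) u y
    · exact .inl (class_eq_iff.2 huy)
    · exact .inr ⟨u, ⟨hu, huy⟩, rfl⟩
  have h3 : c y ∉ c '' {u ∈ G.vertexSet | ¬ Reachable (G.restrict A) u y} := by
    rintro ⟨u, ⟨_, hu⟩, h⟩
    exact hu (class_eq_iff.1 h)
  have hfin : {u ∈ G.vertexSet | ¬ Reachable (G.restrict A) u y}.Finite :=
    hV.subset fun u hu => hu.1
  -- on these vertices, the old and the new components agree
  have h4 : c' '' {u ∈ G.vertexSet | ¬ Reachable (G.restrict A) u y} =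
      (fun S => {z | ∃ w ∈ S, Reachable (G.restrict (insert e A)) w z}) ''
        (c '' {u ∈ G.vertexSet | ¬ Reachable (G.restrict A) u y}) := by
    rw [image_image]
    refine image_congr fun u _ => ?_
    ext z
    exact ⟨fun hz => ⟨u, .refl _ _, hz⟩, fun ⟨w, hw, hwz⟩ => (hmono hw).trans hwz⟩
  have h5 : InjOn (fun S => {z | ∃ w ∈ S, Reachable (G.restrict (insert e A)) w z})
      (c '' {u ∈ G.vertexSet | ¬ Reachable (G.restrict A) u y}) := by
    rintro _ ⟨u, ⟨_, hu⟩, rfl⟩ _ ⟨v, ⟨_, hv⟩, rfl⟩ h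
    refine class_eq_iff.2 ?_
    have hv' : v ∈ {z | ∃ w ∈ c u, Reachable (G.restrict (insert e A)) w z} := by
      rw [show {z | ∃ w ∈ c u, Reachable (G.restrict (insert e A)) w z} = _ from h]
      exact ⟨v, .refl _ _, .refl _ _⟩
    obtain ⟨w, hw, hwv⟩ := hv'
    rcases ((hmono hw).trans hwv).of_restrict_insert he with h | ⟨h, h'⟩ | ⟨h, h'⟩
    · exact h
    · exact absurd h'.symm hv
    · exact absurd h hu
  change (c' '' G.vertexSet).ncard + 1 = (c '' G.vertexSet).ncard
  rw [h2, ncard_insert_of_notMem h3 (hfin.image _), h1, h4, h5.ncard_image]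

lemma numComponents_restrict_empty : numComponents (G.restrict ∅) = G.vertexSet.ncard := by
  refine InjOn.ncard_image fun u _ v _ h => ?_
  have h' : Reachable (G.restrict ∅) u v := class_eq_iff.1 h
  induction h' with
  | refl => rfl
  | tail _ hbc _ =>
    obtain ⟨e, he⟩ := hbc
    exact absurd he.1 (notMem_empty _)

/-- A forest has `|V| - ω` edges. -/
lemma ncard_restrict_add_numComponents (hV : G.vertexSet.Finite) (hA : A.Finite)
    (hAE : A ⊆ G.edgeSet) (h : Acyclic (G.restrict A)) :
    A.ncard + numComponents (G.restrict A) = G.vertexSet.ncard := by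
  induction A, hA using Set.Finite.induction_on with
  | empty => simp [numComponents_restrict_empty]
  | @insert e A heA hA ih =>
    have ih' := ih ((subset_insert _ _).trans hAE)
      (h.mono (G.restrict_mono_right (subset_insert _ _)))
    obtain ⟨x, y, he⟩ := G.exists_isLink_of_mem_edgeSet (hAE (mem_insert _ _))
    have hxy : ¬ Reachable (G.restrict A) x y := by
      have := acyclic_restrict_iff.1 h e (mem_insert _ _) x y he
      rwa [insert_sdiff_self_of_notMem heA] at this
    have := numComponents_restrict_insert_of_not_reachable hV he hxy
    rw [ncard_insert_of_notMem heA hA]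
    omega

lemma card_le_ncard_restrict_add_numComponents (hV : G.vertexSet.Finite) (hA : A.Finite)
    (hAE : A ⊆ G.edgeSet) :
    G.vertexSet.ncard ≤ A.ncard + numComponents (G.restrict A) := by
  induction A, hA using Set.Finite.induction_on with
  | empty => simp [numComponents_restrict_empty]
  | @insert e A heA hA ih =>
    have ih' := ih ((subset_insert _ _).trans hAE)
    obtain ⟨x, y, he⟩ := G.exists_isLink_of_mem_edgeSet (hAE (mem_insert _ _))
    rw [ncard_insert_of_notMem heA hA]
    by_cases hxy : Reachable (G.restrict A) x y
    · have := numComponents_restrict_insert_of_reachable hV he hxy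
      omega
    · have := numComponents_restrict_insert_of_not_reachable hV he hxy
      omega

lemma Acyclic.ncard_add_numComponents (h : Acyclic G) (hV : G.vertexSet.Finite)
    (hE : G.edgeSet.Finite) : G.edgeSet.ncard + numComponents G = G.vertexSet.ncard := by
  have := ncard_restrict_add_numComponents hV hE subset_rfl (by rwa [G.restrict_self])
  rwa [G.restrict_self] at this

/-- A connected graph with `|V| - 1` edges is a tree: if an edge could be removed without
disconnecting the graph, too few edges would be left. -/
lemma isTree_of_connected_of_ncard (h : Connected G) (hV : G.vertexSet.Finite)
    (hE : G.edgeSet.Finite) (hcard : G.edgeSet.ncard + 1 = G.vertexSet.ncard) : IsTree G := by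
  refine ⟨h, ?_⟩
  rw [← G.restrict_self, acyclic_restrict_iff]
  intro e he x y hl hr
  have h1 := numComponents_restrict_insert_of_reachable hV hl hr
  rw [insert_sdiff_self_of_mem he, G.restrict_self, connected_iff_numComponents.1 h] at h1
  have h2 := card_le_ncard_restrict_add_numComponents (A := G.edgeSet \ {e}) hV
    (hE.subset sdiff_subset) sdiff_subset
  have h3 := ncard_sdiff_singleton_add_one he hE
  omega

lemma numComponents_lt_of_isLink (hV : G.vertexSet.Finite) (h : G.IsLink e x y) (hxy : x ≠ y) :
    numComponents G < G.vertexSet.ncard := by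
  refine lt_of_le_of_ne (numComponents_le_card hV) fun heq => hxy ?_
  exact (ncard_image_iff hV).1 heq h.left_mem h.right_mem
    (class_eq_iff.2 (reachable_of_isLink h))

/-! ### Packing forests -/

/-- The sets `I i` are the edge sets of pairwise disjoint forests of `G`. -/
structure IsForestPacking (G : Graph α β) (I : ι → Set β) : Prop where
  subset : ∀ i, I i ⊆ G.edgeSet
  acyclic : ∀ i, Acyclic (G.restrict (I i))
  disjoint : ∀ i j, i ≠ j → Disjoint (I i) (I j)

/-- The edges of `G` that lie in none of the sets `I i`. -/
def uncovered (G : Graph α β) (I : ι → Set β) : Set β := G.edgeSet \ ⋃ i, I i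

/-- `J` is obtained from `I` by an exchange: in one of the sets `I i`, an edge `f` is replaced by
an uncovered edge `e` whose ends `x`, `y` are not joined by a walk in `I i - f`. -/
def Exchange (G : Graph α β) (I J : ι → Set β) : Prop :=
  ∃ (i : ι) (e f : β) (x y : α), G.IsLink e x y ∧ (∀ j, e ∉ I j) ∧ f ∈ I i ∧
    ¬ Reachable (G.restrict (I i \ {f})) x y ∧
    (J i = insert e (I i \ {f}) ∧ ∀ j ≠ i, J j = I j)

lemma IsForestPacking.replace {I J : ι → Set β} (hI : IsForestPacking G I) {i : ι}
    (he : G.IsLink e x y) (heI : ∀ j, e ∉ I j) (hB : B ⊆ I i)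
    (hxy : ¬ Reachable (G.restrict B) x y) (hJi : J i = insert e B) (hJ : ∀ j ≠ i, J j = I j) :
    IsForestPacking G J := by
  have hdis : ∀ j ≠ i, Disjoint (J i) (J j) := fun j hj => by
    rw [hJi, hJ j hj, disjoint_insert_left]
    exact ⟨heI j, (hI.disjoint i j hj.symm).mono_left hB⟩
  refine ⟨fun j => ?_, fun j => ?_, fun j j' hjj' => ?_⟩
  · by_cases hj : j = i
    · subst hj
      rw [hJi]
      exact insert_subset he.edge_mem (hB.trans (hI.subset j))
    · rw [hJ j hj]
      exact hI.subset j
  · by_cases hj : j = i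
    · subst hj
      rw [hJi]
      exact ((hI.acyclic j).mono (G.restrict_mono_right hB)).insert he hxy
    · rw [hJ j hj]
      exact hI.acyclic j
  · by_cases hj : j = i
    · subst hj
      exact hdis j' hjj'.symm
    · by_cases hj' : j' = i
      · subst hj'
        exact (hdis j hj).symm
      · rw [hJ j hj, hJ j' hj']
        exact hI.disjoint j j' hjj'

lemma Exchange.isForestPacking {I J : ι → Set β} (h : Exchange G I J)
    (hI : IsForestPacking G I) : IsForestPacking G J := by
  obtain ⟨i, e, f, x, y, he, heI, -, hxy, hJi, hJ⟩ := h
  exact hI.replace he heI sdiff_subset hxy hJi hJ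

lemma Exchange.ncard_uncovered_le {I J : ι → Set β} (h : Exchange G I J)
    (hE : G.edgeSet.Finite) : (uncovered G J).ncard ≤ (uncovered G I).ncard := by
  obtain ⟨i, e, f, x, y, he, heI, hf, hxy, hJi, hJ⟩ := h
  have heU : e ∈ uncovered G I := ⟨he.edge_mem, by simpa using heI⟩
  have hfin : (uncovered G I).Finite := hE.subset sdiff_subset
  -- the uncovered edges of `J` are those of `I`, with `f` in place of `e`
  have hsub : uncovered G J ⊆ insert f (uncovered G I \ {e}) := by
    rintro g ⟨hgE, hg⟩
    simp only [mem_iUnion, not_exists] at hg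
    by_cases hgf : g = f
    · exact .inl hgf
    · refine .inr ⟨⟨hgE, ?_⟩, ?_⟩
      · simp only [mem_iUnion, not_exists]
        intro j hgj
        by_cases hj : j = i
        · subst hj
          exact hg j (hJi ▸ .inr ⟨hgj, hgf⟩)
        · exact hg j (hJ j hj ▸ hgj)
      · rintro rfl
        exact hg i (hJi ▸ .inl rfl)
  calc (uncovered G J).ncard ≤ (insert f (uncovered G I \ {e})).ncard :=
        ncard_le_ncard hsub ((hfin.subset sdiff_subset).insert f)
    _ ≤ (uncovered G I \ {e}).ncard + 1 := ncard_insert_le _ _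
    _ = (uncovered G I).ncard := ncard_sdiff_singleton_add_one heU hfin

/-- In a forest packing with as few uncovered edges as possible, each forest joins the ends of
each uncovered edge. -/
lemma IsForestPacking.reachable_of_minimal {I : ι → Set β} (hI : IsForestPacking G I)
    (hE : G.edgeSet.Finite)
    (hmin : ∀ J : ι → Set β, IsForestPacking G J → (uncovered G I).ncard ≤ (uncovered G J).ncard)
    (he : G.IsLink e x y) (heI : ∀ j, e ∉ I j) (i : ι) :
    Reachable (G.restrict (I i)) x y := by
  classical
  by_contra hxy
  have hJ := hI.replace (J := Function.update I i (insert e (I i))) he heI subset_rfl hxy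
    (by simp) (fun j hj => by simp [hj])
  have heU : e ∈ uncovered G I := ⟨he.edge_mem, by simpa using heI⟩
  have hsub : uncovered G (Function.update I i (insert e (I i))) ⊂ uncovered G I := by
    refine ⟨fun g hg => ⟨hg.1, fun hgI => hg.2 ?_⟩, fun h => (h heU).2 ?_⟩
    · obtain ⟨j, hj⟩ := mem_iUnion.1 hgI
      refine mem_iUnion.2 ⟨j, ?_⟩
      by_cases hji : j = i
      · subst hji
        simp [hj]
      · simpa [hji] using hj
    · exact mem_iUnion.2 ⟨i, by simp⟩
  exact absurd (ncard_lt_ncard hsub (hE.subset sdiff_subset)) (hmin _ hJ).not_gt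

/-- **Nash-Williams' arboricity theorem**: if every set `F` of edges has at most `|ι| (|V| - ω(F))`
elements, then the edges of `G` can be covered by disjoint forests indexed by `ι`.

In a forest packing `I` with as few uncovered edges as possible, let `C` be the set of the edges
that are left uncovered by some packing obtained from `I` by exchanges. Then each `I i ∩ C` joins
the ends of every edge of `C`, so that `I` covers
`|ι| (|V| - ω(C))` edges of `C`; an uncovered edge of `C` would exceed the bound. -/
theorem exists_isForestPacking_iUnion_eq [Fintype ι] (hV : G.vertexSet.Finite)
    (hE : G.edgeSet.Finite)
    (h : ∀ F ⊆ G.edgeSet,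
      F.ncard + Fintype.card ι * numComponents (G.restrict F) ≤
        Fintype.card ι * G.vertexSet.ncard) :
    ∃ I : ι → Set β, IsForestPacking G I ∧ ⋃ i, I i = G.edgeSet := by
  obtain ⟨I, hI, hmin⟩ : ∃ I : ι → Set β, IsForestPacking G I ∧
      ∀ J : ι → Set β, IsForestPacking G J →
        (uncovered G I).ncard ≤ (uncovered G J).ncard := by
    obtain ⟨I, hI⟩ := exists_minimalFor_of_wellFoundedLT
      (fun I : ι → Set β => IsForestPacking G I) (fun I => (uncovered G I).ncard)
      ⟨fun _ => ∅, by simp, fun _ => acyclic_restrict_empty, by simp⟩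
    exact ⟨I, hI.1, fun J hJ => (le_total _ _).elim id (hI.2 hJ)⟩
  refine ⟨I, hI, subset_antisymm (iUnion_subset hI.subset) ?_⟩
  by_contra hne
  obtain ⟨e₀, he₀E, he₀⟩ := not_subset.1 hne
  have hreach : ∀ J, Relation.ReflTransGen (Exchange G) I J → IsForestPacking G J ∧
      (uncovered G J).ncard ≤ (uncovered G I).ncard := by
    intro J hJ
    induction hJ with
    | refl => exact ⟨hI, le_rfl⟩
    | tail _ hstep ih =>
      exact ⟨hstep.isForestPacking ih.1, (hstep.ncard_uncovered_le hE).trans ih.2⟩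
  set C : Set β := {e | ∃ J, Relation.ReflTransGen (Exchange G) I J ∧ e ∈ uncovered G J} with hC
  have hCE : C ⊆ G.edgeSet := fun e ⟨_, _, he⟩ => he.1
  have hclosed : ∀ J, Relation.ReflTransGen (Exchange G) I J → ∀ e x y, G.IsLink e x y →
      (∀ j, e ∉ J j) → ∀ i, Reachable (G.restrict (J i ∩ C)) x y := by
    intro J hIJ e x y he heJ i
    classical
    obtain ⟨hJ, hJc⟩ := hreach J hIJ
    refine (hJ.acyclic i).reachable_restrict_inter (hE.subset (hJ.subset i))
      (hJ.reachable_of_minimal hE (fun J' hJ' => hJc.trans (hmin J' hJ')) he heJ i) ?_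
    intro f hf hfxy
    refine ⟨Function.update J i (insert e (J i \ {f})), hIJ.tail
      ⟨i, e, f, x, y, he, heJ, hf, hfxy, by simp, fun j hj => by simp [hj]⟩, hJ.subset i hf, ?_⟩
    simp only [mem_iUnion, not_exists]
    intro j
    by_cases hj : j = i
    · subst hj
      have : f ≠ e := fun hfe => heJ j (hfe ▸ hf)
      simp [this]
    · simpa [hj] using (hJ.disjoint i j (Ne.symm hj)).notMem_of_mem_left hf
  have hback : ∀ J, Relation.ReflTransGen (Exchange G) I J → ∀ i u v,
      Reachable (G.restrict (J i ∩ C)) u v → Reachable (G.restrict (I i ∩ C)) u v := by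
    intro J hIJ
    induction hIJ with
    | refl => exact fun _ _ _ => id
    | @tail J J' hIJ hstep ih =>
      intro i u v huv
      refine ih i u v (huv.of_forall_isLink fun g a b hg => ?_)
      obtain ⟨j, e, f, x, y, he, heJ, hf, hxy, hJj, hJ'⟩ := hstep
      by_cases hij : i = j
      · subst hij
        obtain ⟨⟨hgJ, hgC⟩, hgl⟩ := hg
        rw [hJj] at hgJ
        rcases hgJ with rfl | hgJ
        · exact hclosed J hIJ g a b hgl heJ i
        · exact reachable_of_isLink (e := g) ⟨⟨hgJ.1, hgC⟩, hgl⟩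
      · rw [hJ' i hij] at hg
        exact reachable_of_isLink hg
  have hcomp : ∀ i, numComponents (G.restrict (I i ∩ C)) ≤ numComponents (G.restrict C) := by
    refine fun i => numComponents_anti (by exact hV) rfl fun u v huv =>
      huv.of_forall_isLink fun g a b hg => ?_
    obtain ⟨⟨J, hIJ, hgJ⟩, hgl⟩ := hg
    exact hback J hIJ i a b (hclosed J hIJ g a b hgl (by simpa using hgJ.2) i)
  have hcard : ∀ i, G.vertexSet.ncard ≤ (I i ∩ C).ncard + numComponents (G.restrict C) := by
    intro i
    have := ncard_restrict_add_numComponents hV (hE.subset (inter_subset_right.trans hCE))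
      (inter_subset_right.trans hCE)
      ((hI.acyclic i).mono (G.restrict_mono_right (inter_subset_left (t := C))))
    have := hcomp i
    omega
  have hCfin : C.Finite := hE.subset hCE
  have he₀C : e₀ ∈ C := ⟨I, .refl, he₀E, he₀⟩
  have hsum : ∑ i, (I i ∩ C).ncard + 1 ≤ C.ncard := by
    have h1 : (⋃ i, I i ∩ C).ncard = ∑ i, (I i ∩ C).ncard := by
      rw [ncard_iUnion_of_finite (fun i => hCfin.subset inter_subset_right)
        (fun i j hij => (hI.disjoint i j hij).mono inter_subset_left inter_subset_left),
        finsum_eq_sum_of_fintype]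
    have h2 : (⋃ i, I i ∩ C) ⊂ C := by
      refine ⟨iUnion_subset fun i => inter_subset_right, fun hss => he₀ ?_⟩
      rw [← iUnion_inter] at hss
      exact (hss he₀C).1
    have := ncard_lt_ncard h2 hCfin
    omega
  have hsum' := Finset.sum_le_sum fun i (_ : i ∈ Finset.univ) => hcard i
  rw [Finset.sum_add_distrib] at hsum'
  simp only [Finset.sum_const, Finset.card_univ, smul_eq_mul] at hsum'
  have := h C hCE
  omega

/-! ### Multigraphs and density -/

lemma IsMultigraph.mono (hG : IsMultigraph G) (hHG : H ≤ G) : IsMultigraph H :=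
  ⟨hG.finite_vertexSet.subset hHG.vertexSet_mono, hG.finite_edgeSet.subset hHG.edgeSet_mono,
    hG.loopless.anti hHG⟩

lemma IsMultigraph.ne_of_isLink (hG : IsMultigraph G) (h : G.IsLink e x y) : x ≠ y := by
  rintro rfl
  exact hG.loopless.not_isLoopAt e x h

/-- Every subgraph of a union of `m` forests satisfies the sparsity bound
`|E(H)| ≤ m (|V(H)| - ω(H))`. -/
lemma IsForestPacking.ncard_edgeSet_add_le {I : Fin m → Set β} (hI : IsForestPacking G I)
    (hU : G.edgeSet ⊆ ⋃ i, I i) (hHG : H ≤ G) (hV : H.vertexSet.Finite)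
    (hE : H.edgeSet.Finite) :
    H.edgeSet.ncard + m * numComponents H ≤ m * H.vertexSet.ncard := by
  have h1 : ∀ i, (H.edgeSet ∩ I i).ncard + numComponents H ≤ H.vertexSet.ncard := by
    intro i
    have h2 := Acyclic.ncard_add_numComponents (G := H.restrict (I i))
      ((hI.acyclic i).mono (Graph.restrict_mono_left hHG _)) hV (hE.subset inter_subset_left)
    have h3 : numComponents H ≤ numComponents (H.restrict (I i)) :=
      numComponents_anti hV rfl fun _ _ h => h.mono Graph.restrict_le
    simp only [Graph.edgeSet_restrict, Graph.vertexSet_restrict] at h2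
    omega
  have h2 : H.edgeSet.ncard ≤ ∑ i, (H.edgeSet ∩ I i).ncard := by
    refine le_trans (ncard_le_ncard (fun e he => ?_)
      (finite_iUnion fun i => hE.subset inter_subset_left)) (ncard_iUnion_le_of_fintype _)
    obtain ⟨i, hi⟩ := mem_iUnion.1 (hU (hHG.edgeSet_mono he))
    exact mem_iUnion.2 ⟨i, he, hi⟩
  have h3 := Finset.sum_le_sum fun i (_ : i ∈ Finset.univ) => h1 i
  rw [Finset.sum_add_distrib] at h3
  simp only [Finset.sum_const, Finset.card_univ, smul_eq_mul, Fintype.card_fin] at h3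
  omega

lemma card_sub_numComponents_pos (hV : G.vertexSet.Finite)
    (h : G.vertexSet.ncard ≠ numComponents G) :
    (0 : ℚ) < G.vertexSet.ncard - numComponents G := by
  rw [sub_pos]
  exact_mod_cast (numComponents_le_card hV).lt_of_ne h.symm

lemma density_le_iff (hV : G.vertexSet.Finite) (h : G.vertexSet.ncard ≠ numComponents G) :
    density G ≤ k ↔
      G.edgeSet.ncard + k * numComponents G ≤ k * G.vertexSet.ncard := by
  rw [density, div_le_iff₀ (card_sub_numComponents_pos hV h), mul_sub, le_sub_iff_add_le]
  exact_mod_cast Iff.rfl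

lemma density_eq_iff (hV : G.vertexSet.Finite) (h : G.vertexSet.ncard ≠ numComponents G) :
    density G = k ↔
      G.edgeSet.ncard + k * numComponents G = k * G.vertexSet.ncard := by
  rw [density, div_eq_iff (card_sub_numComponents_pos hV h).ne', mul_sub, eq_sub_iff_add_eq]
  exact_mod_cast Iff.rfl

lemma isK1_iff (hG : IsMultigraph G) : IsK1 G ↔ G.vertexSet.ncard = 1 := by
  rw [ncard_eq_one]
  constructor
  · rintro ⟨x, rfl⟩
    exact ⟨x, rfl⟩
  · rintro ⟨x, hx⟩
    refine ⟨x, Graph.ext hx fun e u v => ⟨fun h => hG.ne_of_isLink h ?_, False.elim⟩⟩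
    have hu : u ∈ ({x} : Set α) := hx ▸ h.left_mem
    have hv : v ∈ ({x} : Set α) := hx ▸ h.right_mem
    exact hu.trans hv.symm

/-! ### Packing spanning trees -/

lemma IsTreePacking.isForestPacking {T : Fin m → Set β} (hT : IsTreePacking G T) :
    IsForestPacking G T :=
  ⟨fun i => (hT.1 i).1, fun i => (hT.1 i).2.2, hT.2⟩

lemma IsTreePacking.ncard_add_one {T : Fin m → Set β} (hT : IsTreePacking G T)
    (hG : IsMultigraph G) (i : Fin m) : (T i).ncard + 1 = G.vertexSet.ncard := by
  have h := ncard_restrict_add_numComponents hG.finite_vertexSet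
    (hG.finite_edgeSet.subset (hT.1 i).1) (hT.1 i).1 (hT.1 i).2.2
  rwa [connected_iff_numComponents.1 (hT.1 i).2.1] at h

lemma IsForestPacking.ncard_iUnion {I : Fin m → Set β} (hI : IsForestPacking G I)
    (hE : G.edgeSet.Finite) : (⋃ i, I i).ncard = ∑ i, (I i).ncard := by
  rw [ncard_iUnion_of_finite (fun i => hE.subset (hI.subset i)) hI.disjoint,
    finsum_eq_sum_of_fintype]

lemma IsTreePacking.ncard_iUnion_add {T : Fin m → Set β} (hT : IsTreePacking G T)
    (hG : IsMultigraph G) : (⋃ i, T i).ncard + m = m * G.vertexSet.ncard := by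
  have h := Finset.sum_congr rfl fun i (_ : i ∈ Finset.univ) => hT.ncard_add_one hG i
  rw [Finset.sum_add_distrib] at h
  rw [hT.isForestPacking.ncard_iUnion hG.finite_edgeSet]
  simpa using h

lemma IsTreePacking.mul_card_le {T : Fin m → Set β} (hT : IsTreePacking G T)
    (hG : IsMultigraph G) : m * G.vertexSet.ncard ≤ G.edgeSet.ncard + m := by
  have h1 := hT.ncard_iUnion_add hG
  have h2 := ncard_le_ncard (iUnion_subset fun i => (hT.1 i).1) hG.finite_edgeSet
  omega

/-- When `k` disjoint forests cover a graph with `k (|V| - 1)` edges, each of them is a spanning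
tree, as a forest has at most `|V| - 1` edges. -/
lemma IsForestPacking.isTreePacking {I : Fin k → Set β} (hI : IsForestPacking G I)
    (hG : IsMultigraph G) (hne : G.vertexSet.Nonempty) (hU : ⋃ i, I i = G.edgeSet)
    (hcard : G.edgeSet.ncard + k = k * G.vertexSet.ncard) : IsTreePacking G I := by
  have hle : ∀ i, (I i).ncard + numComponents (G.restrict (I i)) = G.vertexSet.ncard := fun i =>
    ncard_restrict_add_numComponents hG.finite_vertexSet (hG.finite_edgeSet.subset (hI.subset i))
      (hI.subset i) (hI.acyclic i)
  have hpos : ∀ i, 1 ≤ numComponents (G.restrict (I i)) := fun i =>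
    numComponents_pos hG.finite_vertexSet hne
  have hsum := Finset.sum_congr rfl fun i (_ : i ∈ Finset.univ) => hle i
  rw [Finset.sum_add_distrib, ← hI.ncard_iUnion hG.finite_edgeSet, hU] at hsum
  have hk : ∑ i : Fin k, 1 = ∑ i, numComponents (G.restrict (I i)) := by
    simp only [Finset.sum_const, Finset.card_univ, smul_eq_mul, Fintype.card_fin] at hsum ⊢
    omega
  refine ⟨fun i => ⟨hI.subset i, ?_, hI.acyclic i⟩, hI.disjoint⟩
  rw [connected_iff_numComponents]
  exact ((Finset.sum_eq_sum_iff_of_le fun i _ => hpos i).1 hk i (Finset.mem_univ i)).symm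

/-- The two kinds of parts of the edge-joins in question are the connected graphs that decompose
into `k` spanning trees. -/
lemma isK1_or_uniformlyDense_iff (hk : 0 < k) (hG : IsMultigraph G) (hc : Connected G) :
    (IsK1 G ∨ (UniformlyDense G ∧ density G = k)) ↔
      ∃ T : Fin k → Set β, IsTreePacking G T ∧ ⋃ i, T i = G.edgeSet := by
  have hc1 := connected_iff_numComponents.1 hc
  constructor
  · intro h
    have key : G.edgeSet.ncard + k = k * G.vertexSet.ncard ∧ ∀ F ⊆ G.edgeSet,
        F.ncard + k * numComponents (G.restrict F) ≤ k * G.vertexSet.ncard := by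
      rcases h with ⟨x, rfl⟩ | ⟨⟨_, hmax⟩, hd⟩
      · refine ⟨by simp, fun F hF => ?_⟩
        have hF : F = ∅ := subset_empty_iff.1 hF
        subst hF
        simp [numComponents_restrict_empty]
      · have hne : G.vertexSet.ncard ≠ numComponents G := fun h => by
          have h0 : (0 : ℚ) = k := by rw [← hd, density, h, sub_self, div_zero]
          exact hk.ne (by exact_mod_cast h0)
        refine ⟨by simpa [hc1] using (density_eq_iff hG.finite_vertexSet hne).1 hd, fun F hF => ?_⟩
        rcases F.eq_empty_or_nonempty with rfl | ⟨e, he⟩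
        · simp [numComponents_restrict_empty]
        obtain ⟨x, y, hxy⟩ := G.exists_isLink_of_mem_edgeSet (hF he)
        have hne' : (G.restrict F).vertexSet.ncard ≠ numComponents (G.restrict F) :=
          (numComponents_lt_of_isLink (G := G.restrict F) hG.finite_vertexSet ⟨he, hxy⟩
            (hG.ne_of_isLink hxy)).ne'
        have hle := hmax.2 ⟨G.restrict F, Graph.restrict_le, hne', rfl⟩
        rw [hd, density_le_iff (G := G.restrict F) hG.finite_vertexSet hne'] at hle
        simpa [inter_eq_self_of_subset_right hF] using hle
    obtain ⟨I, hI, hU⟩ := exists_isForestPacking_iUnion_eq (ι := Fin k) hG.finite_vertexSet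
      hG.finite_edgeSet (by simpa using key.2)
    exact ⟨I, hI.isTreePacking hG hc.1 hU key.1, hU⟩
  · rintro ⟨T, hT, hU⟩
    have hcard := hT.ncard_iUnion_add hG
    rw [hU] at hcard
    rw [isK1_iff hG]
    refine or_iff_not_imp_left.2 fun h1 => ?_
    have hV : 1 < G.vertexSet.ncard := by
      have := (ncard_pos hG.finite_vertexSet).2 hc.1
      omega
    have hne : G.vertexSet.ncard ≠ numComponents G := by omega
    have hd : density G = k := by
      rw [density_eq_iff hG.finite_vertexSet hne, hc1, mul_one, hcard]
    refine ⟨⟨?_, ⟨G, le_rfl, hne, rfl⟩, ?_⟩, hd⟩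
    · rw [← ncard_pos hG.finite_edgeSet]
      have := Nat.mul_lt_mul_of_pos_left hV hk
      omega
    · rintro _ ⟨H, hHG, hHne, rfl⟩
      have hH := hG.mono hHG
      rw [hd, density_le_iff hH.finite_vertexSet hHne]
      exact hT.isForestPacking.ncard_edgeSet_add_le hU.ge hHG hH.finite_vertexSet
        hH.finite_edgeSet

/-! ### Edge-connectivity and tree packings -/

/-- Each of the disjoint spanning trees crosses each cut. -/
lemma IsTreePacking.le_encard_edgeBoundary {T : Fin m → Set β} (hT : IsTreePacking G T)
    {X : Set α} (hne : X.Nonempty) (hX : X ⊂ G.vertexSet) :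
    (m : ℕ∞) ≤ (edgeBoundary G X).encard := by
  obtain ⟨x, hx⟩ := hne
  obtain ⟨y, hy, hyX⟩ := exists_of_ssubset hX
  have h : ∀ i, ∃ e, e ∈ T i ∧ e ∈ edgeBoundary G X := fun i => by
    obtain ⟨e, u, v, he, hu, hv⟩ :=
      ((hT.1 i).2.1.2 x (hX.subset hx) y hy).exists_mem_edgeBoundary hx hyX
    exact ⟨e, he.1, u, v, he.2, hu, hv⟩
  choose c hcT hcX using h
  have hc : c.Injective := fun i j hij => by
    by_contra hne
    exact (hT.2 i j hne).notMem_of_mem_left (hcT i) (hij ▸ hcT j)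
  calc (m : ℕ∞) ≤ (range c).encard := by simpa using hc.encard_range
    _ ≤ _ := encard_le_encard (range_subset_iff.2 hcX)

lemma le_treePackingNumber {T : Fin m → Set β} (hT : IsTreePacking G T) :
    (m : ℕ∞) ≤ treePackingNumber G :=
  le_iSup₂_of_le m ⟨T, hT⟩ le_rfl

lemma treePackingNumber_le_edgeConnectivity : treePackingNumber G ≤ edgeConnectivity G :=
  iSup₂_le fun _ ⟨_, hT⟩ => le_iInf₂ fun _ hX => hT.le_encard_edgeBoundary hX.1 hX.2

/-- If `G` has `k` disjoint spanning trees and a cut of at most `k` edges, then `κ'(G) = k` and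
`τ(G) = k`, by weak duality. -/
lemma feasible_of_isTreePacking_of_edgeBoundary (hG : IsMultigraph G) {T : Fin k → Set β}
    (hT : IsTreePacking G T) {X : Set α} (hne : X.Nonempty) (hX : X ⊂ G.vertexSet)
    (hcut : (edgeBoundary G X).encard ≤ k) : Feasible k G.vertexSet.ncard G := by
  have h1 := le_treePackingNumber hT
  have h2 := treePackingNumber_le_edgeConnectivity (G := G)
  have h3 : edgeConnectivity G ≤ k := (iInf₂_le X ⟨hne, hX⟩).trans hcut
  exact ⟨hG, rfl, le_antisymm h3 (h1.trans h2), le_antisymm (h2.trans h3) h1⟩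

lemma exists_isTreePacking_of_treePackingNumber (h : treePackingNumber G = k) :
    ∃ T : Fin k → Set β, IsTreePacking G T := by
  rcases k with _ | k
  · exact ⟨Fin.elim0, fun i => i.elim0, fun i => i.elim0⟩
  by_contra hnot
  have hle : treePackingNumber G ≤ k := iSup₂_le fun m ⟨T, hT⟩ => by
    by_contra hm
    have hkm : k + 1 ≤ m := by
      have : k < m := by exact_mod_cast not_le.1 hm
      omega
    exact hnot ⟨fun i => T (i.castLE hkm), fun i => hT.1 _, fun i j hij =>
      hT.2 _ _ fun h => hij (Fin.castLE_injective hkm h)⟩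
  rw [h] at hle
  have : k + 1 ≤ k := by exact_mod_cast hle
  omega

lemma exists_edgeBoundary_of_edgeConnectivity (h : edgeConnectivity G = k) :
    ∃ X : Set α, X.Nonempty ∧ X ⊂ G.vertexSet ∧ (edgeBoundary G X).encard = k := by
  by_contra! hnot
  have hle : ((k + 1 : ℕ) : ℕ∞) ≤ edgeConnectivity G := le_iInf₂ fun X hX => by
    have h1 : (k : ℕ∞) ≤ (edgeBoundary G X).encard := h ▸ iInf₂_le X hX
    push_cast
    exact Order.add_one_le_of_lt (lt_of_le_of_ne h1 (hnot X hX.1 hX.2).symm)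
  rw [h] at hle
  have : k + 1 ≤ k := by exact_mod_cast hle
  omega

/-! ### The minimum number of edges -/

/-- The star with leaves indexed by `Fin m`, whose centre `0` is joined to each leaf by `k` parallel
edges. -/
def multiStar (m k : ℕ) : Graph (ULift.{u} (Fin (m + 1))) (ULift.{v} (Fin m × Fin k)) where
  vertexSet := univ
  edgeSet := univ
  IsLink e x y := (x = ⟨0⟩ ∧ y = ⟨e.down.1.succ⟩) ∨ (x = ⟨e.down.1.succ⟩ ∧ y = ⟨0⟩)
  isLink_symm e _ := ⟨fun x y h => h.symm.imp And.symm And.symm⟩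
  eq_or_eq_of_isLink_of_isLink := by
    rintro e x y v w (⟨rfl, rfl⟩ | ⟨rfl, rfl⟩) (⟨rfl, rfl⟩ | ⟨rfl, rfl⟩) <;> simp
  edge_mem_iff_exists_isLink e := ⟨fun _ => ⟨_, _, .inl ⟨rfl, rfl⟩⟩, fun _ => mem_univ _⟩
  left_mem_of_isLink _ _ _ _ := mem_univ _

lemma isMultigraph_multiStar : IsMultigraph (multiStar.{u, v} m k) where
  finite_vertexSet := toFinite _
  finite_edgeSet := toFinite _
  loopless := ⟨fun e x h => by
    rcases h with ⟨h1, h2⟩ | ⟨h1, h2⟩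
    · exact absurd (congrArg ULift.down (h2.symm.trans h1)) (Fin.succ_ne_zero _)
    · exact absurd (congrArg ULift.down (h1.symm.trans h2)) (Fin.succ_ne_zero _)⟩

lemma ncard_vertexSet_multiStar : (multiStar.{u, v} m k).vertexSet.ncard = m + 1 := by
  simp [multiStar, ncard_univ]

lemma ncard_edgeSet_multiStar : (multiStar.{u, v} m k).edgeSet.ncard = m * k := by
  simp [multiStar, ncard_univ]

lemma isTreePacking_multiStar :
    IsTreePacking (multiStar.{u, v} m k) fun j : Fin k => {e | e.down.2 = j} := by
  refine ⟨fun j => ⟨subset_univ _, ?_⟩, fun i j hij => disjoint_left.2 fun e hi hj =>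
    hij (hi.symm.trans hj)⟩
  refine isTree_of_connected_of_ncard ⟨⟨⟨0⟩, mem_univ _⟩, ?_⟩ (toFinite _) (toFinite _) ?_
  · have h : ∀ x, Reachable ((multiStar.{u, v} m k).restrict {e | e.down.2 = j}) ⟨0⟩ x := by
      rintro ⟨x⟩
      cases x using Fin.cases with
      | zero => exact .refl _ _
      | succ i => exact reachable_of_isLink (e := ⟨(i, j)⟩) ⟨rfl, .inl ⟨rfl, rfl⟩⟩
    exact fun x _ y _ => (h x).symm.trans (h y)
  · have h : ((multiStar.{u, v} m k).restrict {e | e.down.2 = j}).edgeSet =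
        (fun i : Fin m => (⟨(i, j)⟩ : ULift.{v} (Fin m × Fin k))) '' univ := by
      ext ⟨i, j'⟩
      simp [multiStar, eq_comm]
    rw [h, ncard_image_of_injective _ fun i i' h => by simpa using h, Graph.vertexSet_restrict,
      ncard_vertexSet_multiStar]
    simp [ncard_univ]

lemma feasible_multiStar (hm : 0 < m) : Feasible k (m + 1) (multiStar.{u, v} m k) := by
  -- the cut around a leaf
  set l : Fin m := ⟨0, hm⟩
  have h := feasible_of_isTreePacking_of_edgeBoundary isMultigraph_multiStar.{u, v}
    (isTreePacking_multiStar (m := m) (k := k)) (X := {⟨l.succ⟩}) (singleton_nonempty _) ?_ ?_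
  · rwa [ncard_vertexSet_multiStar] at h
  · refine ⟨subset_univ _, fun h => ?_⟩
    have h0 : (⟨0⟩ : ULift.{u} (Fin (m + 1))) ∈ ({⟨l.succ⟩} : Set _) := h (mem_univ _)
    exact (Fin.succ_ne_zero l) (congrArg ULift.down h0).symm
  · have hsub : edgeBoundary (multiStar.{u, v} m k) {⟨l.succ⟩} ⊆
        range fun j : Fin k => (⟨(l, j)⟩ : ULift.{v} (Fin m × Fin k)) := by
      rintro ⟨i, j⟩ ⟨x, y, h, hx, -⟩
      obtain rfl : x = ⟨l.succ⟩ := hx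
      rcases h with ⟨h, -⟩ | ⟨h, -⟩
      · exact (Fin.succ_ne_zero l (congrArg ULift.down h)).elim
      · have hi : l = i := Fin.succ_injective _ (congrArg ULift.down h)
        exact ⟨j, by rw [hi]⟩
    refine (encard_le_encard hsub).trans ?_
    rw [← image_univ]
    exact (encard_image_le _ _).trans (by simp [encard_univ])

/-- `k` disjoint spanning trees require `k (n - 1)` edges, and a star with `k` parallel edges to
each leaf shows that so many edges suffice. -/
lemma memFk_iff (hG : IsMultigraph G) : MemFk k G ↔
    1 < G.vertexSet.ncard ∧ Feasible k G.vertexSet.ncard G ∧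
      G.edgeSet.ncard + k = k * G.vertexSet.ncard := by
  constructor
  · rintro ⟨n, hn, hF, hmin⟩
    obtain rfl := hF.2.1
    refine ⟨hn, hF, ?_⟩
    obtain ⟨T, hT⟩ := exists_isTreePacking_of_treePackingNumber hF.2.2.2
    have h1 := hT.mul_card_le hG
    obtain ⟨m, hm⟩ : ∃ m, G.vertexSet.ncard = m + 1 := ⟨G.vertexSet.ncard - 1, by omega⟩
    have h2 := hmin _ _ (multiStar m k) (by
      rw [hm]
      exact feasible_multiStar (by omega))
    rw [ncard_edgeSet_multiStar] at h2
    rw [hm, mul_add, mul_one] at h1 ⊢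
    rw [mul_comm] at h2
    omega
  · rintro ⟨hn, hF, hcard⟩
    refine ⟨_, hn, hF, fun α' β' H hH => ?_⟩
    obtain ⟨T, hT⟩ := exists_isTreePacking_of_treePackingNumber hH.2.2.2
    have h1 := hT.mul_card_le hH.1
    rw [hH.2.1] at h1
    omega

/-! ### Edge-joins -/

lemma Connected.restrict_union_insert (hVG : G.vertexSet = G₁.vertexSet ∪ G₂.vertexSet)
    (h₁ : G₁ ≤ G) (h₂ : G₂ ≤ G) {T₁ T₂ : Set β} (hT₁ : Connected (G₁.restrict T₁))
    (hT₂ : Connected (G₂.restrict T₂)) (hx : x ∈ G₁.vertexSet) (hy : y ∈ G₂.vertexSet)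
    (he : G.IsLink e x y) : Connected (G.restrict (insert e (T₁ ∪ T₂))) := by
  have hle₁ : G₁.restrict T₁ ≤ G.restrict (insert e (T₁ ∪ T₂)) :=
    (Graph.restrict_mono_left h₁ _).trans
      (G.restrict_mono_right (subset_union_left.trans (subset_insert _ _)))
  have hle₂ : G₂.restrict T₂ ≤ G.restrict (insert e (T₁ ∪ T₂)) :=
    (Graph.restrict_mono_left h₂ _).trans
      (G.restrict_mono_right (subset_union_right.trans (subset_insert _ _)))
  have hxy : Reachable (G.restrict (insert e (T₁ ∪ T₂))) x y :=
    reachable_of_isLink (e := e) ⟨mem_insert _ _, he⟩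
  have h : ∀ z ∈ G.vertexSet, Reachable (G.restrict (insert e (T₁ ∪ T₂))) x z := by
    intro z hz
    rcases hVG.subset hz with hz | hz
    · exact (hT₁.2 x hx z hz).mono hle₁
    · exact hxy.trans ((hT₂.2 y hy z hz).mono hle₂)
  exact ⟨⟨x, he.left_mem⟩, fun z hz w hw => (h z hz).symm.trans (h w hw)⟩

lemma IsEdgeJoin.disjoint_edgeSet (h : IsEdgeJoin G G₁ G₂ K) :
    Disjoint G₁.edgeSet G₂.edgeSet := by
  refine disjoint_left.2 fun e h1 h2 => ?_
  obtain ⟨x, y, hxy⟩ := G₁.exists_isLink_of_mem_edgeSet h1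
  have hxy₂ : G₂.IsLink e x y := (h.right_le.isLink_iff h2).2 (hxy.mono h.left_le)
  exact h.disjoint.notMem_of_mem_left hxy.left_mem hxy₂.left_mem

lemma IsEdgeJoin.disjoint_join_left (h : IsEdgeJoin G G₁ G₂ K) : Disjoint K G₁.edgeSet := by
  refine disjoint_left.2 fun e hK h1 => ?_
  obtain ⟨x, hx, y, hy, hxy⟩ := h.link_join e hK
  exact h.disjoint.notMem_of_mem_left ((h.left_le.isLink_iff h1).2 hxy).right_mem hy

lemma IsEdgeJoin.disjoint_join_right (h : IsEdgeJoin G G₁ G₂ K) : Disjoint K G₂.edgeSet := by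
  refine disjoint_left.2 fun e hK h2 => ?_
  obtain ⟨x, hx, y, hy, hxy⟩ := h.link_join e hK
  exact h.disjoint.notMem_of_mem_left hx ((h.right_le.isLink_iff h2).2 hxy).left_mem

/-- The cut between the two sides of an edge-join consists of joining edges. -/
lemma IsEdgeJoin.edgeBoundary_subset (h : IsEdgeJoin G G₁ G₂ K) :
    edgeBoundary G G₁.vertexSet ⊆ K := by
  rintro e ⟨x, y, hxy, hx, hy⟩
  rcases h.edgeSet_eq.subset hxy.edge_mem with (he | he) | he
  · exact absurd ((h.left_le.isLink_iff he).2 hxy).right_mem hy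
  · exact absurd ((h.right_le.isLink_iff he).2 hxy).left_mem
      (h.disjoint.notMem_of_mem_left hx)
  · exact he

/-- Spanning trees of the two sides of an edge-join, paired up and linked by one joining edge each,
give disjoint spanning trees. -/
lemma IsEdgeJoin.isTreePacking (h : IsEdgeJoin G G₁ G₂ K) (hG : IsMultigraph G)
    {T₁ T₂ : Fin k → Set β} (hT₁ : IsTreePacking G₁ T₁) (hT₂ : IsTreePacking G₂ T₂)
    {c : Fin k → β} (hc : c.Injective) (hcK : ∀ i, c i ∈ K) :
    IsTreePacking G fun i => insert (c i) (T₁ i ∪ T₂ i) := by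
  have hG₁ := hG.mono h.left_le
  have hG₂ := hG.mono h.right_le
  have hc₁ : ∀ i j, c i ∉ T₁ j := fun i j hj =>
    h.disjoint_join_left.notMem_of_mem_left (hcK i) ((hT₁.1 j).1 hj)
  have hc₂ : ∀ i j, c i ∉ T₂ j := fun i j hj =>
    h.disjoint_join_right.notMem_of_mem_left (hcK i) ((hT₂.1 j).1 hj)
  have h12 : ∀ i j, Disjoint (T₁ i) (T₂ j) := fun i j =>
    h.disjoint_edgeSet.mono (hT₁.1 i).1 (hT₂.1 j).1
  refine ⟨fun i => ?_, fun i j hij => ?_⟩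
  · obtain ⟨x, hx, y, hy, hxy⟩ := h.link_join (c i) (hcK i)
    have hsub : insert (c i) (T₁ i ∪ T₂ i) ⊆ G.edgeSet :=
      insert_subset hxy.edge_mem (union_subset ((hT₁.1 i).1.trans h.left_le.edgeSet_mono)
        ((hT₂.1 i).1.trans h.right_le.edgeSet_mono))
    refine ⟨hsub, isTree_of_connected_of_ncard
      (Connected.restrict_union_insert h.vertexSet_eq h.left_le h.right_le (hT₁.1 i).2.1
        (hT₂.1 i).2.1 hx hy hxy) hG.finite_vertexSet
        (hG.finite_edgeSet.subset inter_subset_left) ?_⟩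
    have hf₁ : (T₁ i).Finite := hG₁.finite_edgeSet.subset (hT₁.1 i).1
    have hf₂ : (T₂ i).Finite := hG₂.finite_edgeSet.subset (hT₂.1 i).1
    rw [Graph.edgeSet_restrict, inter_eq_self_of_subset_right hsub, Graph.vertexSet_restrict,
      ncard_insert_of_notMem (by simp [hc₁, hc₂]) (hf₁.union hf₂),
      ncard_union_eq (h12 i i) hf₁ hf₂, h.vertexSet_eq,
      ncard_union_eq h.disjoint hG₁.finite_vertexSet hG₂.finite_vertexSet]
    have := hT₁.ncard_add_one hG₁ i
    have := hT₂.ncard_add_one hG₂ i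
    omega
  · simp only [disjoint_insert_left, disjoint_union_left, disjoint_insert_right,
      disjoint_union_right, mem_insert_iff, mem_union, not_or]
    exact ⟨⟨fun hij' => hij (hc hij'.symm), hc₁ j i, hc₂ j i⟩,
      ⟨hc₁ i j, hT₁.2 i j hij, (h12 j i).symm⟩, hc₂ i j, h12 i j, hT₂.2 i j hij⟩

lemma memFk_of_isKEdgeJoin (hG : IsMultigraph G) (h : IsKEdgeJoin k G G₁ G₂)
    (h₁ : ∃ T : Fin k → Set β, IsTreePacking G₁ T ∧ ⋃ i, T i = G₁.edgeSet)
    (h₂ : ∃ T : Fin k → Set β, IsTreePacking G₂ T ∧ ⋃ i, T i = G₂.edgeSet) : MemFk k G := by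
  obtain ⟨K, hK, h⟩ := h
  obtain ⟨T₁, hT₁, hU₁⟩ := h₁
  obtain ⟨T₂, hT₂, hU₂⟩ := h₂
  have hG₁ := hG.mono h.left_le
  have hG₂ := hG.mono h.right_le
  have hKf : K.Finite := finite_of_encard_eq_coe hK
  have hKn : K.ncard = k := by rw [ncard, hK, ENat.toNat_natCast]
  have hn₁ := (ncard_pos hG₁.finite_vertexSet).2 h.connected_left.1
  have hn₂ := (ncard_pos hG₂.finite_vertexSet).2 h.connected_right.1
  have hV : G.vertexSet.ncard = G₁.vertexSet.ncard + G₂.vertexSet.ncard := by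
    rw [h.vertexSet_eq, ncard_union_eq h.disjoint hG₁.finite_vertexSet hG₂.finite_vertexSet]
  have hc₁ := hT₁.ncard_iUnion_add hG₁
  have hc₂ := hT₂.ncard_iUnion_add hG₂
  rw [memFk_iff hG]
  refine ⟨by omega, ?_, ?_⟩
  · have e : Fin k ≃ K := by
      have : Finite K := hKf
      exact (Finite.equivFinOfCardEq (by rw [← hKn]; rfl)).symm
    refine feasible_of_isTreePacking_of_edgeBoundary hG
      (h.isTreePacking hG hT₁ hT₂ (c := fun i => e i)
        (Subtype.val_injective.comp e.injective) fun i => (e i).2)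
      (X := G₁.vertexSet) h.connected_left.1 ⟨h.left_le.vertexSet_mono, fun hle => ?_⟩
      (hK ▸ encard_le_encard h.edgeBoundary_subset)
    obtain ⟨y, hy⟩ := h.connected_right.1
    exact h.disjoint.notMem_of_mem_left (hle (h.right_le.vertexSet_mono hy)) hy
  · rw [h.edgeSet_eq, ncard_union_eq (disjoint_union_left.2
        ⟨h.disjoint_join_left.symm, h.disjoint_join_right.symm⟩)
        (hG₁.finite_edgeSet.union hG₂.finite_edgeSet) hKf,
      ncard_union_eq h.disjoint_edgeSet hG₁.finite_edgeSet hG₂.finite_edgeSet, hV, hKn, mul_add]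
    rw [hU₁] at hc₁
    rw [hU₂] at hc₂
    omega

/-- The edges of `G` are those within `X`, those within the complement of `X`, and those of the
boundary of `X`. -/
lemma edgeSet_eq_induce_union (X : Set α) :
    G.edgeSet = (G.induce X).edgeSet ∪ (G.induce (G.vertexSet \ X)).edgeSet ∪
      edgeBoundary G X := by
  refine subset_antisymm (fun e he => ?_) ?_
  · obtain ⟨x, y, hxy⟩ := G.exists_isLink_of_mem_edgeSet he
    by_cases hx : x ∈ X <;> by_cases hy : y ∈ X
    · exact .inl (.inl ⟨x, y, hxy, hx, hy⟩)
    · exact .inr ⟨x, y, hxy, hx, hy⟩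
    · exact .inr ⟨y, x, hxy.symm, hy, hx⟩
    · exact .inl (.inr ⟨x, y, hxy, ⟨hxy.left_mem, hx⟩, hxy.right_mem, hy⟩)
  · rintro e ((⟨x, y, h, -⟩ | ⟨x, y, h, -⟩) | ⟨x, y, h, -⟩) <;> exact h.edge_mem

/-- Restricting the members of a decomposition into `k` spanning trees to a nonempty subgraph with
exactly `k (|V| - 1)` edges gives spanning trees of that subgraph. -/
lemma IsTreePacking.exists_restrict {T : Fin k → Set β} (hT : IsTreePacking G T)
    (hU : ⋃ i, T i = G.edgeSet) (hHG : H ≤ G) (hH : IsMultigraph H) (hne : H.vertexSet.Nonempty)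
    (hcard : H.edgeSet.ncard + k = k * H.vertexSet.ncard) :
    ∃ T : Fin k → Set β, IsTreePacking H T ∧ ⋃ i, T i = H.edgeSet := by
  have hI : IsForestPacking H fun i => H.edgeSet ∩ T i := by
    refine ⟨fun i => inter_subset_left, fun i => ?_, fun i j hij =>
      (hT.2 i j hij).mono inter_subset_right inter_subset_right⟩
    rw [Graph.restrict_edgeSet_inter]
    exact (hT.1 i).2.2.mono (Graph.restrict_mono_left hHG _)
  have hU' : ⋃ i, H.edgeSet ∩ T i = H.edgeSet := by
    rw [← inter_iUnion, hU, inter_eq_self_of_subset_left hHG.edgeSet_mono]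
  exact ⟨_, hI.isTreePacking hH hne hU' hcard, hU'⟩

/-- A cut of size `k` in a graph that decomposes into `k` spanning trees splits it into two sides that
are connected and decompose into `k` spanning trees themselves, as the sparsity bounds
`|E(Gᵢ)| ≤ k (|V(Gᵢ)| - ω(Gᵢ))` have to hold with equality and with `ω(Gᵢ) = 1`. -/
lemma exists_isKEdgeJoin_of_memFk (hk : 0 < k) (hG : IsMultigraph G) (h : MemFk k G) :
    ∃ G₁ G₂ : Graph α β, IsKEdgeJoin k G G₁ G₂ ∧
      (∃ T : Fin k → Set β, IsTreePacking G₁ T ∧ ⋃ i, T i = G₁.edgeSet) ∧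
      (∃ T : Fin k → Set β, IsTreePacking G₂ T ∧ ⋃ i, T i = G₂.edgeSet) := by
  obtain ⟨-, hF, hcard⟩ := (memFk_iff hG).1 h
  obtain ⟨X, hXne, hX, hcut⟩ := exists_edgeBoundary_of_edgeConnectivity hF.2.2.1
  obtain ⟨T, hT⟩ := exists_isTreePacking_of_treePackingNumber hF.2.2.2
  have hU : ⋃ i, T i = G.edgeSet := by
    refine eq_of_subset_of_ncard_le (iUnion_subset fun i => (hT.1 i).1) ?_ hG.finite_edgeSet
    have := hT.ncard_iUnion_add hG
    omega
  have hle₁ : G.induce X ≤ G := Graph.induce_le hX.subset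
  have hle₂ : G.induce (G.vertexSet \ X) ≤ G := Graph.induce_le sdiff_subset
  have hG₁ := hG.mono hle₁
  have hG₂ := hG.mono hle₂
  have hne₂ : (G.vertexSet \ X).Nonempty := nonempty_of_ssubset hX
  have hV : (G.induce X).vertexSet.ncard + (G.induce (G.vertexSet \ X)).vertexSet.ncard =
      G.vertexSet.ncard := by
    rw [add_comm]
    exact ncard_sdiff_add_ncard_of_subset hX.subset hG.finite_vertexSet
  have hE : G.edgeSet.ncard ≤ (G.induce X).edgeSet.ncard +
      (G.induce (G.vertexSet \ X)).edgeSet.ncard + k := by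
    have hB : (edgeBoundary G X).ncard = k := by rw [ncard, hcut, ENat.toNat_natCast]
    conv_lhs => rw [edgeSet_eq_induce_union X]
    refine (ncard_union_le _ _).trans ?_
    rw [hB]
    exact Nat.add_le_add_right (ncard_union_le _ _) k
  have h1 := hT.isForestPacking.ncard_edgeSet_add_le hU.ge hle₁ hG₁.finite_vertexSet
    hG₁.finite_edgeSet
  have h2 := hT.isForestPacking.ncard_edgeSet_add_le hU.ge hle₂ hG₂.finite_vertexSet
    hG₂.finite_edgeSet
  have hp1 := numComponents_pos hG₁.finite_vertexSet (by exact hXne)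
  have hp2 := numComponents_pos hG₂.finite_vertexSet (by exact hne₂)
  rw [← hV, mul_add] at hcard
  have hω : k * (numComponents (G.induce X) + numComponents (G.induce (G.vertexSet \ X))) ≤
      k * 2 := by
    rw [mul_add]
    omega
  have hω' := Nat.le_of_mul_le_mul_left hω hk
  have hω₁ : numComponents (G.induce X) = 1 := by omega
  have hω₂ : numComponents (G.induce (G.vertexSet \ X)) = 1 := by omega
  rw [hω₁, mul_one] at h1
  rw [hω₂, mul_one] at h2
  refine ⟨G.induce X, G.induce (G.vertexSet \ X), ⟨edgeBoundary G X, hcut, ?_⟩,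
    hT.exists_restrict hU hle₁ hG₁ hXne (by omega),
    hT.exists_restrict hU hle₂ hG₂ hne₂ (by omega)⟩
  exact {
    connected_left := connected_iff_numComponents.2 hω₁
    connected_right := connected_iff_numComponents.2 hω₂
    disjoint := disjoint_sdiff_right
    left_le := hle₁
    right_le := hle₂
    link_join := fun e ⟨x, y, hxy, hx, hy⟩ => ⟨x, hx, y, ⟨hxy.right_mem, hy⟩, hxy⟩
    vertexSet_eq := (union_sdiff_cancel hX.subset).symm
    edgeSet_eq := edgeSet_eq_induce_union X }

end EdgeJoin

theorem mainTheorem4 {α β : Type*} (k : ℕ) (hk : 0 < k) (G : Graph α β)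
    (hG : EdgeJoin.IsMultigraph G) :
    EdgeJoin.MemFk k G ↔
      ∃ G₁ G₂ : Graph α β, EdgeJoin.IsKEdgeJoin k G G₁ G₂ ∧
        (EdgeJoin.IsK1 G₁ ∨ (EdgeJoin.UniformlyDense G₁ ∧ EdgeJoin.density G₁ = k)) ∧
        (EdgeJoin.IsK1 G₂ ∨ (EdgeJoin.UniformlyDense G₂ ∧ EdgeJoin.density G₂ = k)) := by
  have key : ∀ {G₁ G₂ : Graph α β}, EdgeJoin.IsKEdgeJoin k G G₁ G₂ → _ ∧ _ :=
    fun ⟨_, _, h⟩ =>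
      ⟨EdgeJoin.isK1_or_uniformlyDense_iff hk (hG.mono h.left_le) h.connected_left,
        EdgeJoin.isK1_or_uniformlyDense_iff hk (hG.mono h.right_le) h.connected_right⟩
  constructor
  · intro h
    obtain ⟨G₁, G₂, hJ, h₁, h₂⟩ := EdgeJoin.exists_isKEdgeJoin_of_memFk hk hG h
    exact ⟨G₁, G₂, hJ, (key hJ).1.2 h₁, (key hJ).2.2 h₂⟩
  · rintro ⟨G₁, G₂, hJ, h₁, h₂⟩
    exact EdgeJoin.memFk_of_isKEdgeJoin hG hJ ((key hJ).1.1 h₁) ((key hJ).2.1 h₂)
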